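/- All C*-algebras are complex; "algebra" means unital associative complex algebra, and algebra homomorphisms are unital and complex linear. A pattern of algebras on a topological space $X$ is a contravariant functor $\mathcal P$ from the lattice of closed subsets of $X$ (ordered by inclusion) to algebras such that for all closed $C\subset X$ and all closed $C_0,\dots,C_n$ with $C=C_0\cup\dots\cup C_n$ the diagram $\mathcal P(C)\to\prod_{\alpha}\mathcal P(C_\alpha)\rightrightarrows\prod_{\alpha,\beta}\mathcal P(C_\alpha\cap C_\beta)$ is an equalizer. It is global if every restriction $\mathcal P(X)\to\mathcal P(C)$ is surjective. A compact Hausdorff globally algebraized space is a compact Hausdorff space $X$ with a global pattern of algebras $\mathcal A_X$; a morphism $(X,\mathcal A_X)\to(Y,\mathcal A_Y)$ is a continuous map $f:X\to Y$ together with a natural transformation $\mathcal A_Y\to f_*\mathcal A_X$, where $(f_*\mathcal A_X)(D)=\mathcal A_X(f^{-1}(D))$. Consider the category of pairs $(A,L)$, where $A$ is a unital commutative C*-algebra and $L$ is the lattice of all closed *-ideals of $A$, with unital *-homomorphisms $\varphi:A\to B$ (the preimage under $\varphi$ of every closed *-ideal of $B$ is one of $A$) as morphisms. For such a pair let $X=\operatorname{Spec}A$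 be the Gelfand spectrum and, for closed $C\subset X$, let $I(C)\subset A$ be the ideal of all $a$ with $\chi(a)=0$ for all $\chi\in C$. Theorem. (1) For every $(A,L)$, the assignment $C\mapsto I(C)$ is an inclusion-reversing bijection, with inclusion-reversing inverse, from the closed subsets of $\operatorname{Spec}A$ onto $L$, and $I(C\cup D)=I(C)\cap I(D)$, $I(C\cap D)=I(C)+I(D)$. (2) For every $(A,L)$, the functor $\mathcal A_X(C)=A/I(C)$, with the canonical projections as restrictions, is a global pattern of algebras on the compact Hausdorff space $X=\operatorname{Spec}A$. (3) The assignment $(A,L)\mapsto(\operatorname{Spec}A,\mathcal A_{\operatorname{Spec}A})$, sending $\varphi:A\to B$ to the continuous map $f:\operatorname{Spec}B\to\operatorname{Spec}A$, $\chi\mapsto\chi\circ\varphi$, together with the homomorphisms $A/I(D)\to B/I(f^{-1}(D))$ induced by $\varphi$, is a full and faithful functor, injective on isomorphism classes of objects, from the opposite of the category of pairs $(A,L)$ to the category of compact Hausdorff globally algebraized spaces. -/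

import Mathlib

open CategoryTheory Opposite TopologicalSpace

universe u

/-! ## Patterns and algebraized spaces -/

/-- The preimage functor from closed subsets of `Y` to closed subsets of `X` along a continuous
map `f : X → Y`. -/
def closedsPreimage {X Y : TopCat.{u}} (f : X ⟶ Y) : Closeds Y ⥤ Closeds X where
  obj D := D.preimage f.hom.continuous
  map h := homOfLE (fun _ hx => leOfHom h hx)

/-- The restriction map `P(C) → P(D)` for closed subsets `D ⊆ C`. -/
def restrictClosed {X : TopCat.{u}} (P : (Closeds X)ᵒᵖ ⥤ AlgCat.{u} ℂ) {D C : Closeds X}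
    (h : D ≤ C) : P.obj (op C) →ₐ[ℂ] P.obj (op D) :=
  (P.map (homOfLE h).op).hom

/-- A contravariant functor from the lattice of closed subsets of `X` to (unital, associative)
complex algebras is a *pattern* if it has unique gluing along all coverings `C = C₀ ∪ ⋯ ∪ Cₙ` of
closed subsets by finitely many closed subsets, that is, if
`P(C) → ∏ P(Cᵢ) ⇉ ∏ P(Cᵢ ∩ Cⱼ)` is always an equalizer. -/
def IsPattern {X : TopCat.{u}} (P : (Closeds X)ᵒᵖ ⥤ AlgCat.{u} ℂ) : Prop :=
  ∀ (n : ℕ) (C : Closeds X) (D : Fin (n + 1) → Closeds X) (hD : ∀ i, D i ≤ C),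
    (C : Set X) = ⋃ i, (D i : Set X) →
    ∀ s : ∀ i, P.obj (op (D i)),
      (∀ i j, restrictClosed P (inf_le_left : D i ⊓ D j ≤ D i) (s i) =
        restrictClosed P (inf_le_right : D i ⊓ D j ≤ D j) (s j)) →
      ∃! t : P.obj (op C), ∀ i, restrictClosed P (hD i) t = s i

/-- `P` is *global* if every restriction `P(X) → P(C)` is surjective. -/
def IsGlobal {X : TopCat.{u}} (P : (Closeds X)ᵒᵖ ⥤ AlgCat.{u} ℂ) : Prop :=
  ∀ C : Closeds X, Function.Surjective (restrictClosed P (le_top : C ≤ ⊤))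

/-- A topological space with a contravariant functor from its closed subsets to complex
algebras (no gluing condition yet). -/
structure PreAlgSpace : Type (u + 1) where
  space : TopCat.{u}
  pat : (Closeds space)ᵒᵖ ⥤ AlgCat.{u} ℂ

namespace PreAlgSpace

/-- A morphism `(X, 𝒜_X) → (Y, 𝒜_Y)`: a continuous map `f : X → Y` together with a natural
transformation `𝒜_Y → f_* 𝒜_X`, where `(f_* 𝒜_X)(D) = 𝒜_X(f⁻¹ D)`. -/
structure Hom (X Y : PreAlgSpace.{u}) : Type u where
  base : X.space ⟶ Y.space
  app : Y.pat ⟶ (closedsPreimage base).op ⋙ X.pat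

/-- The category of topological spaces with a functor on closed subsets. -/
instance : Category PreAlgSpace.{u} where
  Hom := Hom
  id X := ⟨𝟙 X.space, { app := fun D => 𝟙 (X.pat.obj D) }⟩
  comp {X Y Z} F G := ⟨F.base ≫ G.base,
    { app := fun D => G.app.app D ≫ F.app.app ((closedsPreimage G.base).op.obj D)
      naturality := fun _ _ h =>
        (G.app ≫ Functor.whiskerLeft (closedsPreimage G.base).op F.app).naturality h }⟩

end PreAlgSpace

/-- The compact Hausdorff globally algebraized spaces. -/
def IsCompHausGlobal : ObjectProperty PreAlgSpace.{u} := fun X =>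
  CompactSpace X.space ∧ T2Space X.space ∧ IsPattern X.pat ∧ IsGlobal X.pat

/-- The category of compact Hausdorff globally algebraized spaces. -/
abbrev CompHausGlobAlgSpace : Type (u + 1) := IsCompHausGlobal.{u}.FullSubcategory

/-! ## C*-algebras with their lattices of closed *-ideals -/

/-- A unital commutative C*-algebra equipped with its lattice of closed *-ideals. -/
structure CStarWithIdeals : Type (u + 1) where
  carrier : Type u
  [inst : CommCStarAlgebra carrier]
  ideals : Set (Ideal carrier)
  mem_ideals : ∀ I : Ideal carrier,
    I ∈ ideals ↔ IsClosed (I : Set carrier) ∧ ∀ a ∈ I, star a ∈ I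

namespace CStarWithIdeals

attribute [instance] CStarWithIdeals.inst

/-- Morphisms are unital *-homomorphisms along which the ideals of the target lattice pull back
to ideals of the source lattice. -/
@[ext]
structure Hom (A B : CStarWithIdeals.{u}) : Type u where
  hom : A.carrier →⋆ₐ[ℂ] B.carrier
  comap_mem : ∀ J ∈ B.ideals, Ideal.comap hom J ∈ A.ideals

/-- The category of unital commutative C*-algebras with their lattices of closed *-ideals. -/
instance : Category CStarWithIdeals.{u} where
  Hom := Hom
  id A := ⟨StarAlgHom.id ℂ A.carrier, fun _ hJ => hJ⟩
  comp F G := ⟨G.hom.comp F.hom, fun J hJ => F.comap_mem _ (G.comap_mem J hJ)⟩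

/-- The Gelfand spectrum. -/
noncomputable def spec (A : CStarWithIdeals.{u}) : TopCat.{u} :=
  TopCat.of (WeakDual.characterSpace ℂ A.carrier)

/-- The ideal of all elements of `A` whose Gelfand transform vanishes on the closed subset `C` of
the spectrum. -/
def vanishingIdeal (A : CStarWithIdeals.{u}) (C : Closeds A.spec) : Ideal A.carrier where
  carrier := {a | ∀ χ : WeakDual.characterSpace ℂ A.carrier, χ ∈ (C : Set A.spec) → χ a = 0}
  add_mem' ha hb χ hχ := by rw [map_add, ha χ hχ, hb χ hχ, add_zero]
  zero_mem' χ _ := map_zero χ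
  smul_mem' c a ha χ hχ := by rw [smul_eq_mul, map_mul, ha χ hχ, mul_zero]

theorem vanishingIdeal_anti (A : CStarWithIdeals.{u}) {C D : Closeds A.spec} (h : D ≤ C) :
    A.vanishingIdeal C ≤ A.vanishingIdeal D :=
  fun _ ha χ hχ => ha χ (h hχ)

/-- The functor `C ↦ A / I(C)` on closed subsets of the spectrum, with the canonical
projections as restriction maps. -/
noncomputable def quotientPattern (A : CStarWithIdeals.{u}) :
    (Closeds A.spec)ᵒᵖ ⥤ AlgCat.{u} ℂ where
  obj C := AlgCat.of ℂ (A.carrier ⧸ A.vanishingIdeal C.unop)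
  map h := AlgCat.ofHom (Ideal.Quotient.factorₐ ℂ (A.vanishingIdeal_anti (leOfHom h.unop)))
  map_id C := by
    apply AlgCat.hom_ext
    exact Ideal.Quotient.factorₐ_refl _
  map_comp f g := by
    apply AlgCat.hom_ext
    exact (Ideal.Quotient.factorₐ_comp ℂ _ _).symm

/-- The continuous map `χ ↦ χ ∘ φ` of spectra induced by `φ : A → B`. -/
noncomputable def specMap {A B : CStarWithIdeals.{u}} (φ : A ⟶ B) : B.spec ⟶ A.spec :=
  TopCat.ofHom (WeakDual.CharacterSpace.compContinuousMap φ.hom)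

theorem vanishingIdeal_le_comap {A B : CStarWithIdeals.{u}} (φ : A ⟶ B) (D : Closeds A.spec) :
    A.vanishingIdeal D ≤
      (B.vanishingIdeal ((closedsPreimage (specMap φ)).obj D)).comap φ.hom.toAlgHom :=
  fun _ ha χ hχ => ha (WeakDual.CharacterSpace.compContinuousMap φ.hom χ) hχ

/-- The map `𝒜_{Spec A} → (Spec φ)_* 𝒜_{Spec B}` given by `a + I(D) ↦ φ(a) + I((Spec φ)⁻¹ D)`. -/
noncomputable def quotientPatternMap {A B : CStarWithIdeals.{u}} (φ : A ⟶ B) :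
    A.quotientPattern ⟶ (closedsPreimage (specMap φ)).op ⋙ B.quotientPattern where
  app D := AlgCat.ofHom
    (Ideal.quotientMapₐ _ φ.hom.toAlgHom (vanishingIdeal_le_comap φ D.unop))
  naturality D E h := by
    apply AlgCat.hom_ext
    apply Ideal.Quotient.algHom_ext
    rfl

end CStarWithIdeals

/-- The contravariant Gelfand–Naimark functor: it sends `A` to its spectrum with the functor
`C ↦ A / I(C)` on closed subsets. -/
noncomputable def gelfandNaimark : CStarWithIdeals.{u}ᵒᵖ ⥤ PreAlgSpace.{u} where
  obj A := ⟨A.unop.spec, A.unop.quotientPattern⟩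
  map φ := ⟨CStarWithIdeals.specMap φ.unop, CStarWithIdeals.quotientPatternMap φ.unop⟩
  map_id A := by
    refine congrArg (PreAlgSpace.Hom.mk _) ?_
    apply NatTrans.ext
    funext D
    apply AlgCat.hom_ext
    apply Ideal.Quotient.algHom_ext
    rfl
  map_comp φ ψ := by
    refine congrArg (PreAlgSpace.Hom.mk _) ?_
    apply NatTrans.ext
    funext D
    apply AlgCat.hom_ext
    apply Ideal.Quotient.algHom_ext
    rfl

/-! By Gelfand duality an element of `A` is the same as a continuous function on the compact
Hausdorff space `Spec A`, so every claim becomes one about functions. Urysohn's lemma recovers `C`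
from `I(C)`, and every closed ideal of `C(X, ℂ)` is the ideal of functions vanishing on a closed
set. Gluing rests on one extension fact: functions agreeing on overlaps of finitely many closed sets
paste to a continuous function on the union, which Tietze extends to the whole space. This yields
both the pattern property and `I(C ∩ D) ⊆ I(C) + I(D)`. For fullness, let `(f, η)` be a morphism.
Since `I(Spec B) = 0`, the component of `η` at `Spec A` gives a homomorphism `ψ : A → B`, and
naturality makes `ψ` induce all other components. The components at points force `χ ∘ ψ = f(χ)`;
hence `ψ` preserves the star and `f` is its dual. Faithfulness holds because characters separate
elements of `B`. -/

theorem ContinuousMap.exists_eqOn_of_finite_isClosed {X ι : Type*} [TopologicalSpace X]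
    [NormalSpace X] [Finite ι] (D : ι → Set X) (hD : ∀ i, IsClosed (D i)) (f : ι → C(X, ℂ))
    (hf : ∀ i j, Set.EqOn (f i) (f j) (D i ∩ D j)) :
    ∃ g : C(X, ℂ), ∀ i, Set.EqOn g (f i) (D i) := by
  have hmem : ∀ x : (⋃ i, D i : Set X), ∃ i, (x : X) ∈ D i := fun x => Set.mem_iUnion.1 x.2
  choose k hk using hmem
  have hval : ∀ i (x : (⋃ i, D i : Set X)), (x : X) ∈ D i → f (k x) x = f i x :=
    fun i x hx => hf _ _ ⟨hk x, hx⟩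
  have hcont : Continuous fun x : (⋃ i, D i : Set X) => f (k x) x := by
    refine (locallyFinite_of_finite fun i => (Subtype.val ⁻¹' D i : Set (⋃ i, D i : Set X))).continuous
      ?_ (fun i => (hD i).preimage continuous_subtype_val) fun i => ?_
    · exact Set.eq_univ_of_forall fun x => Set.mem_iUnion.2 ⟨k x, hk x⟩
    · exact ((f i).continuous.comp continuous_subtype_val).continuousOn.congr fun x hx => hval i x hx
  obtain ⟨g, hg⟩ := ContinuousMap.exists_restrict_eq (isClosed_iUnion_of_finite hD) ⟨_, hcont⟩
  refine ⟨g, fun i x hx => ?_⟩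
  have hx' : x ∈ ⋃ i, D i := Set.mem_iUnion.2 ⟨i, hx⟩
  exact (DFunLike.congr_fun hg ⟨x, hx'⟩).trans (hval i ⟨x, hx'⟩ hx)

/-! ### Elements as functions on the spectrum -/

namespace CStarWithIdeals

variable (A : CStarWithIdeals.{u})

instance : CompactSpace A.spec :=
  inferInstanceAs (CompactSpace (WeakDual.characterSpace ℂ A.carrier))

instance : T2Space A.spec :=
  inferInstanceAs (T2Space (WeakDual.characterSpace ℂ A.carrier))

variable {A}

theorem exists_forall_apply_eq (g : C(WeakDual.characterSpace ℂ A.carrier, ℂ)) :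
    ∃ a : A.carrier, ∀ χ : WeakDual.characterSpace ℂ A.carrier, χ a = g χ := by
  obtain ⟨a, ha⟩ := (gelfandTransform_bijective A.carrier).2 g
  exact ⟨a, fun χ => DFunLike.congr_fun ha χ⟩

theorem eq_of_forall_apply_eq {a b : A.carrier}
    (h : ∀ χ : WeakDual.characterSpace ℂ A.carrier, χ a = χ b) : a = b :=
  (gelfandTransform_bijective A.carrier).1 (ContinuousMap.ext h)

theorem mem_vanishingIdeal {C : Closeds A.spec} {a : A.carrier} :
    a ∈ A.vanishingIdeal C ↔
      ∀ χ : WeakDual.characterSpace ℂ A.carrier, χ ∈ (C : Set A.spec) → χ a = 0 :=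
  Iff.rfl

theorem vanishingIdeal_eq_bot {C : Closeds A.spec} (hC : ∀ χ, χ ∈ C) :
    A.vanishingIdeal C = ⊥ :=
  (Submodule.eq_bot_iff _).2 fun _ ha =>
    eq_of_forall_apply_eq fun χ => (ha χ (hC χ)).trans (map_zero χ).symm

/-- Elements that agree modulo `I(Dᵢ ∩ Dⱼ)` can be glued modulo the ideals `I(Dᵢ)`. -/
theorem exists_sub_mem_vanishingIdeal {ι : Type*} [Finite ι] (D : ι → Closeds A.spec)
    (a : ι → A.carrier) (h : ∀ i j, a i - a j ∈ A.vanishingIdeal (D i ⊓ D j)) :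
    ∃ b, ∀ i, b - a i ∈ A.vanishingIdeal (D i) := by
  obtain ⟨g, hg⟩ := ContinuousMap.exists_eqOn_of_finite_isClosed
    (X := A.spec) (fun i => (D i : Set A.spec))
    (fun i => (D i).isClosed) (fun i => WeakDual.gelfandTransform ℂ A.carrier (a i))
    fun i j χ hχ => by
      let ω : WeakDual.characterSpace ℂ A.carrier := χ
      have hω : ω (a i - a j) = 0 := h i j χ hχ
      rw [map_sub, sub_eq_zero] at hω
      exact hω
  obtain ⟨b, hb⟩ := exists_forall_apply_eq g
  refine ⟨b, fun i χ hχ => ?_⟩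
  rw [map_sub, sub_eq_zero]
  exact (hb χ).trans (hg i hχ)

/-! ### Closed subsets and closed ideals -/

theorem vanishingIdeal_le_iff {C D : Closeds A.spec} :
    A.vanishingIdeal C ≤ A.vanishingIdeal D ↔ D ≤ C := by
  refine ⟨fun h χ hχ => ?_, A.vanishingIdeal_anti⟩
  by_contra hC
  -- A Urysohn function, 0 on `C` and 1 at `χ`, is the transform of an element of `I(C)` outside
  -- `I(D)`.
  obtain ⟨f, hf0, hf1, -⟩ := exists_continuous_zero_one_of_isClosed C.isClosed
    (isClosed_singleton (x := χ)) (Set.disjoint_singleton_right.2 hC)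
  obtain ⟨a, ha⟩ := exists_forall_apply_eq (A := A) ⟨fun ψ => (f ψ : ℂ), by fun_prop⟩
  have h0 : a ∈ A.vanishingIdeal C := fun ψ hψ => by
    rw [ha]
    exact Complex.ofReal_eq_zero.2 (hf0 hψ)
  have h1 := (ha χ).symm.trans (h h0 χ hχ)
  have h2 : f χ = 1 := hf1 rfl
  simp [h2] at h1

theorem vanishingIdeal_injective : Function.Injective A.vanishingIdeal := fun _ _ h =>
  le_antisymm (vanishingIdeal_le_iff.1 h.ge) (vanishingIdeal_le_iff.1 h.le)

theorem vanishingIdeal_mem_ideals (C : Closeds A.spec) : A.vanishingIdeal C ∈ A.ideals := by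
  refine (A.mem_ideals _).2 ⟨?_, fun a ha χ hχ => ?_⟩
  · have : (A.vanishingIdeal C : Set A.carrier) =
        ⋂ (χ : WeakDual.characterSpace ℂ A.carrier) (_ : χ ∈ (C : Set A.spec)), {a | χ a = 0} := by
      ext a
      simp [mem_vanishingIdeal]
    rw [this]
    exact isClosed_biInter fun χ _ => isClosed_eq (map_continuous χ) continuous_const
  · rw [map_star, ha χ hχ, star_zero]

/-- The Gelfand transform is an isometric isomorphism, so it carries `I` to a closed ideal `J` of
functions; `C` is the common zero set of `J`. -/
theorem exists_vanishingIdeal_eq {I : Ideal A.carrier} (hI : IsClosed (I : Set A.carrier)) :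
    ∃ C, A.vanishingIdeal C = I := by
  let e := (gelfandStarTransform A.carrier).toRingEquiv
  let J := I.comap e.symm.toRingHom
  have hJ : IsClosed (J : Set C(WeakDual.characterSpace ℂ A.carrier, ℂ)) := by
    have : (J : Set C(WeakDual.characterSpace ℂ A.carrier, ℂ)) =
        WeakDual.gelfandTransform ℂ A.carrier '' I := by
      ext g
      constructor
      · exact fun hg => ⟨e.symm g, hg, e.apply_symm_apply g⟩
      · rintro ⟨a, ha, rfl⟩
        change e.symm (e a) ∈ I
        rwa [e.symm_apply_apply]
    rw [this]
    exact (gelfandTransform_isometry A.carrier).isClosedEmbedding.isClosedMap _ hI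
  refine ⟨⟨(ContinuousMap.setOfIdeal J)ᶜ, (ContinuousMap.setOfIdeal_open J).isClosed_compl⟩, ?_⟩
  ext a
  have h : a ∈ I ↔ e a ∈ J := by
    change a ∈ I ↔ e.symm (e a) ∈ I
    rw [e.symm_apply_apply]
  have hJ' := congrArg (e a ∈ ·) (ContinuousMap.idealOfSet_ofIdeal_isClosed hJ)
  rw [h, ← hJ', ContinuousMap.mem_idealOfSet]
  rfl

theorem bijOn_vanishingIdeal : Set.BijOn A.vanishingIdeal Set.univ A.ideals :=
  ⟨fun C _ => vanishingIdeal_mem_ideals C, vanishingIdeal_injective.injOn, fun I hI =>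
    (exists_vanishingIdeal_eq ((A.mem_ideals I).1 hI).1).imp fun _ h => ⟨trivial, h⟩⟩

theorem vanishingIdeal_sup (C D : Closeds A.spec) :
    A.vanishingIdeal (C ⊔ D) = A.vanishingIdeal C ⊓ A.vanishingIdeal D :=
  le_antisymm (le_inf (A.vanishingIdeal_anti le_sup_left) (A.vanishingIdeal_anti le_sup_right))
    fun _ ha χ hχ => hχ.elim (ha.1 χ) (ha.2 χ)

theorem vanishingIdeal_inf (C D : Closeds A.spec) :
    A.vanishingIdeal (C ⊓ D) = A.vanishingIdeal C ⊔ A.vanishingIdeal D := by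
  refine le_antisymm (fun a ha => ?_)
    (sup_le (A.vanishingIdeal_anti inf_le_left) (A.vanishingIdeal_anti inf_le_right))
  -- Glue `0` on `C` with `a` on `D`, compatible as `a` vanishes on `C ∩ D`; then `a = b + (a - b)`
  -- is the required decomposition.
  obtain ⟨b, hb⟩ := exists_sub_mem_vanishingIdeal ![C, D] ![0, a] <| by
    have ha' : a ∈ A.vanishingIdeal (D ⊓ C) := inf_comm C D ▸ ha
    simpa [Fin.forall_fin_two] using ⟨ha, ha'⟩
  have h0 : b ∈ A.vanishingIdeal C := by simpa using hb 0
  have h1 : b - a ∈ A.vanishingIdeal D := hb 1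
  exact Submodule.mem_sup.2 ⟨b, h0, a - b, by rw [← neg_sub]; exact neg_mem h1, by ring⟩

/-! ### The global pattern of quotients -/

theorem isGlobal_quotientPattern : IsGlobal A.quotientPattern := fun C s => by
  obtain ⟨a, rfl⟩ := Ideal.Quotient.mk_surjective (I := A.vanishingIdeal C) s
  exact ⟨Ideal.Quotient.mk (A.vanishingIdeal ⊤) a, rfl⟩

theorem isPattern_quotientPattern : IsPattern A.quotientPattern := by
  intro n C D hD hC s hs
  choose a ha using fun i => Ideal.Quotient.mk_surjective (I := A.vanishingIdeal (D i)) (s i)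
  obtain rfl : (fun i => Ideal.Quotient.mk (A.vanishingIdeal (D i)) (a i)) = s := funext ha
  obtain ⟨b, hb⟩ := exists_sub_mem_vanishingIdeal D a fun i j =>
    Ideal.Quotient.eq.1 (hs i j)
  refine ⟨Ideal.Quotient.mk (A.vanishingIdeal C) b, fun i => Ideal.Quotient.eq.2 (hb i),
    fun t ht => ?_⟩
  obtain ⟨c, rfl⟩ := Ideal.Quotient.mk_surjective (I := A.vanishingIdeal C) t
  refine Ideal.Quotient.eq.2 fun χ hχ => ?_
  rw [hC] at hχ
  obtain ⟨i, hi⟩ := Set.mem_iUnion.1 hχ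
  have h1 : c - a i ∈ A.vanishingIdeal (D i) := Ideal.Quotient.eq.1 (ht i)
  have h2 := sub_mem h1 (hb i)
  rw [sub_sub_sub_cancel_right] at h2
  exact h2 χ hi

/-! ### Full faithfulness -/

variable {B : CStarWithIdeals.{u}}

-- Star homomorphisms of C*-algebras are automatically continuous, so closedness pulls back.
open scoped CStarAlgebra in
theorem comap_mem_ideals (φ : A.carrier →⋆ₐ[ℂ] B.carrier) {J : Ideal B.carrier}
    (hJ : J ∈ B.ideals) : Ideal.comap φ J ∈ A.ideals := by
  obtain ⟨hc, hs⟩ := (B.mem_ideals J).1 hJ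
  refine (A.mem_ideals _).2 ⟨hc.preimage (map_continuous φ), fun a ha => ?_⟩
  rw [Ideal.mem_comap, map_star]
  exact hs _ ha

theorem specMap_injective :
    Function.Injective (specMap : (A ⟶ B) → (B.spec ⟶ A.spec)) := by
  intro φ ψ h
  refine Hom.ext (StarAlgHom.ext fun a => eq_of_forall_apply_eq fun χ => ?_)
  have h' : WeakDual.CharacterSpace.compContinuousMap φ.hom χ =
      WeakDual.CharacterSpace.compContinuousMap ψ.hom χ := congrArg (fun f => f.hom χ) h
  exact DFunLike.congr_fun h' a

/-- A natural transformation between quotient patterns over a map of spectra is induced by an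
algebra homomorphism. -/
theorem exists_algHom_forall_app_mk {f : B.spec ⟶ A.spec}
    (η : A.quotientPattern ⟶ (closedsPreimage f).op ⋙ B.quotientPattern) :
    ∃ ψ : A.carrier →ₐ[ℂ] B.carrier, ∀ (D : Closeds A.spec) (a : A.carrier),
      (η.app (op D)).hom (Ideal.Quotient.mk (A.vanishingIdeal D) a) =
        Ideal.Quotient.mk (B.vanishingIdeal ((closedsPreimage f).obj D)) (ψ a) := by
  let I := B.vanishingIdeal ((closedsPreimage f).obj ⊤)
  have hI : I = ⊥ := vanishingIdeal_eq_bot fun χ => trivial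
  -- As `I = 0`, the projection `B → B/I` is invertible, with inverse `l`.
  let l : (B.carrier ⧸ I) →ₐ[ℂ] B.carrier := Ideal.Quotient.liftₐ I (AlgHom.id ℂ B.carrier)
    fun b hb => by rw [hI] at hb; exact hb
  have hl : ∀ x : B.carrier ⧸ I, Ideal.Quotient.mk I (l x) = x := fun x => by
    obtain ⟨b, rfl⟩ := Ideal.Quotient.mk_surjective x
    rfl
  let η₀ : (A.carrier ⧸ A.vanishingIdeal ⊤) →ₐ[ℂ] (B.carrier ⧸ I) := (η.app (op ⊤)).hom
  refine ⟨(l.comp η₀).comp (Ideal.Quotient.mkₐ ℂ (A.vanishingIdeal ⊤)), fun D a => ?_⟩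
  have hn := congrArg (fun g => g.hom (Ideal.Quotient.mk (A.vanishingIdeal ⊤) a))
    (η.naturality (homOfLE (le_top : D ≤ ⊤)).op)
  refine Eq.trans hn ?_
  exact congrArg (restrictClosed B.quotientPattern
    (fun _ _ => trivial : (closedsPreimage f).obj D ≤ (closedsPreimage f).obj ⊤))
    (hl (η₀ (Ideal.Quotient.mk _ a))).symm

/-- Take `D = {f(χ)}` and write `ω = f(χ)`. The element `a - ω(a)·1` lies in `I(D)`, so its image
under `ψ` vanishes on `f⁻¹(D)`, which contains `χ`. -/
theorem apply_eq_of_forall_app_mk {f : B.spec ⟶ A.spec}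
    (η : A.quotientPattern ⟶ (closedsPreimage f).op ⋙ B.quotientPattern)
    {ψ : A.carrier →ₐ[ℂ] B.carrier}
    (hψ : ∀ (D : Closeds A.spec) (a : A.carrier),
      (η.app (op D)).hom (Ideal.Quotient.mk (A.vanishingIdeal D) a) =
        Ideal.Quotient.mk (B.vanishingIdeal ((closedsPreimage f).obj D)) (ψ a))
    (χ : WeakDual.characterSpace ℂ B.carrier) (a : A.carrier) :
    χ (ψ a) = (show WeakDual.characterSpace ℂ A.carrier from f.hom χ) a := by
  let ω : WeakDual.characterSpace ℂ A.carrier := f.hom χ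
  let D : Closeds A.spec := ⟨{f.hom χ}, isClosed_singleton⟩
  have hmem : a - algebraMap ℂ A.carrier (ω a) ∈ A.vanishingIdeal D := by
    rintro _ rfl
    change ω _ = 0
    rw [map_sub, AlgHomClass.commutes]
    exact sub_self _
  have h := hψ D (a - algebraMap ℂ A.carrier (ω a))
  rw [Ideal.Quotient.eq_zero_iff_mem.2 hmem] at h
  have h0 := Ideal.Quotient.eq_zero_iff_mem.1 (h.symm.trans (map_zero (η.app (op D)).hom)) χ rfl
  rw [map_sub, map_sub, AlgHom.commutes, AlgHomClass.commutes, sub_eq_zero] at h0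
  exact h0

theorem exists_gelfandNaimark_map_eq
    (F : gelfandNaimark.obj (op B) ⟶ gelfandNaimark.obj (op A)) :
    ∃ φ : A ⟶ B, gelfandNaimark.map φ.op = F := by
  obtain ⟨f, η⟩ := F
  obtain ⟨ψ, hψ⟩ := exists_algHom_forall_app_mk η
  have hχ := apply_eq_of_forall_app_mk η hψ
  obtain ⟨φ, rfl⟩ : ∃ φ : A.carrier →⋆ₐ[ℂ] B.carrier, φ.toAlgHom = ψ :=
    ⟨{ ψ with
        -- Each `χ ∘ ψ` is a character of `A`, and characters of C*-algebras preserve the star.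
        map_star' := fun a => eq_of_forall_apply_eq fun χ => by
          change χ (ψ (star a)) = χ (star (ψ a))
          rw [map_star χ, hχ, hχ, map_star] }, rfl⟩
  let Φ : A ⟶ B := ⟨φ, fun _ hJ => comap_mem_ideals φ hJ⟩
  refine ⟨Φ, ?_⟩
  -- The type of `η` depends on `f`, so the base maps are identified before the transformations are
  -- compared.
  obtain rfl : specMap Φ = f := by
    apply TopCat.hom_ext
    apply ContinuousMap.ext
    intro χ
    exact WeakDual.CharacterSpace.ext fun a => hχ χ a
  refine congrArg (PreAlgSpace.Hom.mk _) ?_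
  apply NatTrans.ext
  funext D
  apply AlgCat.hom_ext
  apply Ideal.Quotient.algHom_ext
  ext a
  exact (hψ D.unop a).symm

end CStarWithIdeals

instance : gelfandNaimark.{u}.Faithful where
  map_injective h := Quiver.Hom.unop_inj
    (CStarWithIdeals.specMap_injective (congrArg PreAlgSpace.Hom.base h))

instance : gelfandNaimark.{u}.Full where
  map_surjective F :=
    let ⟨φ, hφ⟩ := CStarWithIdeals.exists_gelfandNaimark_map_eq F
    ⟨φ.op, hφ⟩

theorem isCompHausGlobal_gelfandNaimark_obj (A : CStarWithIdeals.{u}ᵒᵖ) :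
    IsCompHausGlobal (gelfandNaimark.obj A) :=
  ⟨inferInstanceAs (CompactSpace A.unop.spec), inferInstanceAs (T2Space A.unop.spec),
    CStarWithIdeals.isPattern_quotientPattern, CStarWithIdeals.isGlobal_quotientPattern⟩

theorem theorem3 :
    (∀ A : CStarWithIdeals.{u},
      Set.BijOn A.vanishingIdeal Set.univ A.ideals ∧
      (∀ C D : Closeds A.spec, A.vanishingIdeal C ≤ A.vanishingIdeal D ↔ D ≤ C) ∧
      (∀ C D : Closeds A.spec,
        A.vanishingIdeal (C ⊔ D) = A.vanishingIdeal C ⊓ A.vanishingIdeal D ∧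
        A.vanishingIdeal (C ⊓ D) = A.vanishingIdeal C ⊔ A.vanishingIdeal D)) ∧
    ∃ h : ∀ A : CStarWithIdeals.{u}ᵒᵖ, IsCompHausGlobal (gelfandNaimark.obj A),
      (IsCompHausGlobal.lift gelfandNaimark h).Full ∧
      (IsCompHausGlobal.lift gelfandNaimark h).Faithful ∧
      ∀ A B : CStarWithIdeals.{u}ᵒᵖ,
        Nonempty ((IsCompHausGlobal.lift gelfandNaimark h).obj A ≅
          (IsCompHausGlobal.lift gelfandNaimark h).obj B) → Nonempty (A ≅ B) := by
  refine ⟨fun A => ⟨CStarWithIdeals.bijOn_vanishingIdeal,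
    fun C D => CStarWithIdeals.vanishingIdeal_le_iff, fun C D =>
      ⟨CStarWithIdeals.vanishingIdeal_sup C D, CStarWithIdeals.vanishingIdeal_inf C D⟩⟩,
    isCompHausGlobal_gelfandNaimark_obj, inferInstance, inferInstance, fun A B ⟨e⟩ =>
      ⟨(IsCompHausGlobal.lift gelfandNaimark isCompHausGlobal_gelfandNaimark_obj).preimageIso e⟩⟩
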